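/- For every real $\epsilon>0$ there exist a real $\delta>0$ and an integer $P$ such that the following holds for every prime $p\ge P$. Let $A$ be a finite multiset of elements of $\mathbb{Z}_p^2$, where $\mathbb{Z}_p=\mathbb{Z}/p\mathbb{Z}$, in which no element has multiplicity $\ge\delta p$, and let $|A|$ denote its cardinality counted with multiplicity. (1) If $|A|>(1+\epsilon)p$, then $A$ contains a zero-sum of length at most $p$, that is, there is a non-empty sub-multiset $B\subseteq A$ with $|B|\le p$ and $\sum_{b\in B}b=0$. (2) If $|A|>(2+\epsilon)p$, then $A$ contains a zero-sum of length exactly $p$, that is, there is a sub-multiset $B\subseteq A$ with $|B|=p$ and $\sum_{b\in B}b=0$. -/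

import Mathlib

/-!
Call an affine line rich if it contains at least a fixed proportion of `p` of the given vectors.

If, outside the rich lines, a positive proportion of `p` vectors remains, a Fourier argument
shows that the differences of these vectors are equidistributed enough for one of them to move a
large part of any set of at most half the plane off itself. Adding such a pair `x`, `y` of
vectors and choosing one of the two replaces a set `Y` of sums by `(a x +ᵥ Y) ∪ (a y +ᵥ Y)`;
doing this greedily, few vectors produce more than half of the plane, and two disjoint such
families produce everything as sums of one common length `m`. The same argument on `ZMod p`
shows that few vectors of a rich line produce all of its `m`-fold multiple, so two rich lines in
different directions also produce the whole plane. Any remaining `p - m` vectors can then be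
completed to a zero-sum of length `p`.

Otherwise almost all vectors lie on boundedly many parallel rich lines, the fibres of one
functional `φ`. Reserve a few vectors on each of them. The one-dimensional zero-sum theorems
provide a long subfamily `B` with `∑ φ = 0`; some line contains many vectors of `B`, and exchanging
part of those for reserved vectors makes the sum zero without changing the length.
-/

open Finset Module
open scoped Pointwise ComplexConjugate

universe u v

section Outflow

variable {G : Type*} [AddCommGroup G] [DecidableEq G]

/-- The number of elements of the translate `g + Y` outside `Y`, which measures how fast `Y` expands
in the direction `g`. -/
def outflow (Y : Finset G) (g : G) : ℕ :=
  #((g +ᵥ Y) \ Y)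

lemma outflow_zero (Y : Finset G) : outflow Y 0 = 0 := by
  simp [outflow]

lemma outflow_add_le (Y : Finset G) (g h : G) : outflow Y (g + h) ≤ outflow Y g + outflow Y h := by
  have hsub : ((g + h) +ᵥ Y) \ Y ⊆ ((g +ᵥ Y) \ Y) ∪ (g +ᵥ ((h +ᵥ Y) \ Y)) := by
    rw [vadd_finset_sdiff, vadd_vadd, union_comm]
    exact sdiff_triangle _ _ _
  calc outflow Y (g + h) ≤ _ := card_le_card hsub
    _ ≤ _ := card_union_le _ _
    _ = outflow Y g + outflow Y h := by rw [card_vadd_finset, outflow, outflow]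

lemma outflow_nsmul_le (Y : Finset G) (j : ℕ) (g : G) : outflow Y (j • g) ≤ j * outflow Y g := by
  induction j with
  | zero => simp [outflow_zero]
  | succ j ih =>
    rw [succ_nsmul, add_mul, one_mul]
    exact (outflow_add_le _ _ _).trans (Nat.add_le_add_right ih _)

lemma card_inter_vadd_add_outflow (Y : Finset G) (g : G) : #(Y ∩ (g +ᵥ Y)) + outflow Y g = #Y := by
  rw [outflow, add_comm, inter_comm, card_sdiff_add_card_inter, card_vadd_finset]

lemma card_union_vadd (Y : Finset G) (g : G) : #(Y ∪ (g +ᵥ Y)) = #Y + outflow Y g := by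
  rw [outflow, add_comm, card_sdiff_add_card, union_comm]

end Outflow

section Fourier

variable {G : Type*} [AddCommGroup G]

/-- The unnormalised Fourier transform of the indicator function of `Y`. -/
noncomputable def charSum (Y : Finset G) (χ : AddChar G ℂ) : ℂ :=
  ∑ y ∈ Y, χ y

lemma charSum_zero (Y : Finset G) : charSum Y 0 = #Y := by
  simp [charSum]

lemma charSum_vadd [DecidableEq G] (Y : Finset G) (g : G) (χ : AddChar G ℂ) :
    charSum (g +ᵥ Y) χ = χ g * charSum Y χ := by
  rw [charSum, charSum, ← image_vadd, sum_image (AddAction.injective g).injOn, mul_sum]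
  exact sum_congr rfl fun y _ => χ.map_add_eq_mul g y

variable [Fintype G]

lemma sum_charSum_mul_conj_charSum [DecidableEq G] (A B : Finset G) :
    ∑ χ, charSum A χ * conj (charSum B χ) = Fintype.card G * #(A ∩ B) := by
  have horth : ∀ a b : G,
      ∑ χ : AddChar G ℂ, χ a * conj (χ b) = if a = b then (Fintype.card G : ℂ) else 0 := by
    intro a b
    simp only [← AddChar.map_neg_eq_conj, ← AddChar.map_add_eq_mul, ← sub_eq_add_neg,
      AddChar.sum_apply_eq_ite, sub_eq_zero]
  calc ∑ χ, charSum A χ * conj (charSum B χ)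
      = ∑ a ∈ A, ∑ b ∈ B, ∑ χ : AddChar G ℂ, χ a * conj (χ b) := by
        simp only [charSum, map_sum, sum_mul_sum]
        rw [sum_comm]
        exact sum_congr rfl fun a _ => sum_comm
    _ = Fintype.card G * #(A ∩ B) := by
        simp only [horth, sum_ite_eq, ← sum_filter, sum_const, nsmul_eq_mul, filter_mem_eq_inter]
        ring

lemma sum_norm_charSum_sq (Y : Finset G) :
    ∑ χ, ‖charSum Y χ‖ ^ 2 = (Fintype.card G * #Y : ℝ) := by
  classical
  have h := sum_charSum_mul_conj_charSum Y Y
  simp only [Complex.mul_conj', inter_self] at h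
  exact_mod_cast h

lemma sum_norm_charSum_sq_mul_one_sub_re [DecidableEq G] (Y : Finset G) (g : G) :
    ∑ χ, ‖charSum Y χ‖ ^ 2 * (1 - (χ g).re) = (Fintype.card G * outflow Y g : ℝ) := by
  have hre : ∑ χ, ‖charSum Y χ‖ ^ 2 * (χ g).re = (Fintype.card G * #((g +ᵥ Y) ∩ Y) : ℝ) := by
    have h := congrArg Complex.re (sum_charSum_mul_conj_charSum (g +ᵥ Y) Y)
    simp only [charSum_vadd, mul_assoc, Complex.mul_conj', Complex.re_sum] at h
    norm_cast at h
    simpa only [mul_comm (_ ^ 2 : ℝ), Complex.re_mul_ofReal, Nat.cast_mul] using h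
  have hcard : (#Y : ℝ) = #((g +ᵥ Y) ∩ Y) + outflow Y g := by
    rw [inter_comm]
    exact_mod_cast (card_inter_vadd_add_outflow Y g).symm
  simp only [mul_one_sub, sum_sub_distrib, sum_norm_charSum_sq, hre, hcard]
  ring

lemma card_mul_card_le_sum_norm_charSum_sq (Y : Finset G) (hY : 2 * #Y ≤ Fintype.card G) :
    (Fintype.card G * #Y : ℝ) ≤ 2 * ∑ χ with χ ≠ 0, ‖charSum Y χ‖ ^ 2 := by
  have hsplit := sum_norm_charSum_sq Y
  have hzero : ({χ | ¬χ ≠ 0} : Finset (AddChar G ℂ)) = {0} := by ext; simp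
  rw [← sum_filter_add_sum_filter_not univ (· ≠ 0), hzero, sum_singleton, charSum_zero,
    Complex.norm_natCast] at hsplit
  have hY' : (2 * #Y : ℝ) ≤ Fintype.card G := by exact_mod_cast hY
  nlinarith [(Nat.cast_nonneg (#Y) : (0 : ℝ) ≤ #Y)]

lemma mul_card_le_two_mul_sum_outflow [DecidableEq G] {κ : Type*} {D : Finset κ} {e : κ → G}
    {c : ℝ} {Y : Finset G}
    (hgap : ∀ χ : AddChar G ℂ, χ ≠ 0 → c ≤ ∑ k ∈ D, (1 - (χ (e k)).re))
    (hc : 0 ≤ c) (hY : 2 * #Y ≤ Fintype.card G) :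
    c * #Y ≤ 2 * ∑ k ∈ D, (outflow Y (e k) : ℝ) := by
  have hnonneg : ∀ χ : AddChar G ℂ, 0 ≤ ∑ k ∈ D, (1 - (χ (e k)).re) := fun χ =>
    sum_nonneg fun k _ => sub_nonneg.2 ((Complex.re_le_norm _).trans_eq (χ.norm_apply _))
  have hle : ∑ χ with χ ≠ 0, ‖charSum Y χ‖ ^ 2 * c ≤
      Fintype.card G * ∑ k ∈ D, (outflow Y (e k) : ℝ) :=
    calc ∑ χ with χ ≠ 0, ‖charSum Y χ‖ ^ 2 * c
        ≤ ∑ χ with χ ≠ 0, ‖charSum Y χ‖ ^ 2 * ∑ k ∈ D, (1 - (χ (e k)).re) :=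
          sum_le_sum fun χ hχ => by gcongr; exact hgap χ (mem_filter.1 hχ).2
      _ ≤ ∑ χ, ‖charSum Y χ‖ ^ 2 * ∑ k ∈ D, (1 - (χ (e k)).re) :=
          sum_le_univ_sum_of_nonneg fun χ => mul_nonneg (sq_nonneg _) (hnonneg χ)
      _ = Fintype.card G * ∑ k ∈ D, (outflow Y (e k) : ℝ) := by
          simp only [mul_sum, ← sum_norm_charSum_sq_mul_one_sub_re]
          exact sum_comm
  rw [← sum_mul] at hle
  have hcard : (0 : ℝ) < Fintype.card G := by exact_mod_cast Fintype.card_pos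
  refine le_of_mul_le_mul_left ?_ hcard
  nlinarith [mul_le_mul_of_nonneg_left (card_mul_card_le_sum_norm_charSum_sq Y hY) hc]

end Fourier

section HyperplaneSparse

variable {ι : Type*} {p : ℕ} {V : Type*} [AddCommGroup V] [Module (ZMod p) V]

/-- Every affine hyperplane of `V` contains at most `K` of the vectors `a i` with `i ∈ S`. -/
def HyperplaneSparse (p : ℕ) {V : Type*} [AddCommGroup V] [Module (ZMod p) V] (a : ι → V)
    (S : Finset ι) (K : ℝ) : Prop :=
  ∀ φ : Dual (ZMod p) V, φ ≠ 0 → ∀ c, (#{i ∈ S | φ (a i) = c} : ℝ) ≤ K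

variable {a : ι → V} {S : Finset ι} {K : ℝ}

lemma HyperplaneSparse.mono (h : HyperplaneSparse p a S K) {S' : Finset ι} (hS : S' ⊆ S) :
    HyperplaneSparse p a S' K := fun φ hφ c =>
  (Nat.cast_le.2 (card_le_card (filter_subset_filter _ hS))).trans (h φ hφ c)

lemma HyperplaneSparse.sub_const (h : HyperplaneSparse p a S K) (v : V) :
    HyperplaneSparse p (fun i => a i - v) S K := fun φ hφ c => by
  simpa only [map_sub, sub_eq_iff_eq_add] using h φ hφ (c + φ v)

variable [Fact p.Prime]

lemma HyperplaneSparse.one_le [Nontrivial V] (h : HyperplaneSparse p a S K) (hS : S.Nonempty) :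
    1 ≤ K := by
  obtain ⟨v, hv⟩ := exists_ne (0 : V)
  obtain ⟨φ, hφ⟩ := not_forall.1 (mt (forall_dual_apply_eq_zero_iff (ZMod p) v).1 hv)
  obtain ⟨i, hi⟩ := hS
  refine le_trans ?_ (h φ (by rintro rfl; exact hφ rfl) (φ (a i)))
  exact Nat.one_le_cast.2 (card_pos.2 ⟨i, mem_filter.2 ⟨hi, rfl⟩⟩)

lemma HyperplaneSparse.span_sub_eq_top (h : HyperplaneSparse p a S K) (hK : K < #S) (x : ι) :
    Submodule.span (ZMod p) ((fun i => a i - a x) '' S) = ⊤ := by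
  by_contra hspan
  obtain ⟨φ, hφ, hker⟩ := Submodule.exists_le_ker_of_lt_top _ (lt_top_iff_ne_top.2 hspan)
  have hconst : ∀ i ∈ S, φ (a i) = φ (a x) := fun i hi => by
    simpa [sub_eq_zero] using hker (Submodule.subset_span (Set.mem_image_of_mem _ hi))
  refine (h φ hφ (φ (a x))).not_gt ?_
  rwa [filter_true_of_mem hconst]

lemma HyperplaneSparse.exists_basis_sub (h : HyperplaneSparse p a S K) (hK : K < #S) (x : ι) :
    ∃ b : Basis (Fin (finrank (ZMod p) V)) (ZMod p) V, ∀ j, ∃ y ∈ S, b j = a y - a x := by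
  have hspan := h.span_sub_eq_top hK x
  have := FiniteDimensional.span_of_finite (ZMod p) (S.finite_toSet.image fun i => a i - a x)
  obtain ⟨f, hf, hfspan, hfind⟩ :=
    Submodule.exists_fun_fin_finrank_span_eq (ZMod p) ((fun i => a i - a x) '' (S : Set ι))
  have hrank : finrank (ZMod p) (Submodule.span (ZMod p) ((fun i => a i - a x) '' (S : Set ι))) =
      finrank (ZMod p) V := by rw [hspan, finrank_top]
  refine ⟨(Basis.mk hfind (hfspan.trans hspan).ge).reindex (finCongr hrank), fun j => ?_⟩
  obtain ⟨y, hy, hyj⟩ := hf ((finCongr hrank).symm j)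
  exact ⟨y, hy, by rw [Basis.reindex_apply, Basis.mk_apply]; exact hyj.symm⟩

lemma exists_dual_of_addChar_ne_zero {χ : AddChar V ℂ} (hχ : χ ≠ 0) :
    ∃ φ : Dual (ZMod p) V, φ ≠ 0 ∧ ∀ v, χ v = 1 → φ v = 0 := by
  have hlt : AddSubgroup.toZModSubmodule p χ.toAddMonoidHom.ker < ⊤ := by
    obtain ⟨v, hv⟩ := AddChar.ne_zero_iff.1 hχ
    refine lt_top_iff_ne_top.2 fun htop => hv ?_
    have : v ∈ AddSubgroup.toZModSubmodule p χ.toAddMonoidHom.ker := htop ▸ Submodule.mem_top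
    exact this
  obtain ⟨φ, hφ, hker⟩ := Submodule.exists_le_ker_of_lt_top _ hlt
  exact ⟨φ, hφ, fun v hv => hker (show v ∈ χ.toAddMonoidHom.ker from hv)⟩

open scoped Classical in
lemma HyperplaneSparse.card_addChar_fiber_le (h : HyperplaneSparse p a S K) {χ : AddChar V ℂ}
    (hχ : χ ≠ 0) (z : ℂ) : (#{i ∈ S | χ (a i) = z} : ℝ) ≤ K := by
  obtain ⟨φ, hφ, hker⟩ := exists_dual_of_addChar_ne_zero (p := p) hχ
  obtain hempty | ⟨x, hx⟩ := ({i ∈ S | χ (a i) = z}).eq_empty_or_nonempty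
  · rw [hempty, card_empty, Nat.cast_zero]
    exact (Nat.cast_nonneg _).trans (h φ hφ 0)
  · refine le_trans ?_ (h φ hφ (φ (a x)))
    refine Nat.cast_le.2 (card_le_card (monotone_filter_right S fun i _ hi => ?_))
    rw [← sub_eq_zero, ← map_sub]
    refine hker _ ?_
    rw [AddChar.map_sub_eq_div, hi, (mem_filter.1 hx).2, div_self]
    exact (mem_filter.1 hx).2 ▸ (χ.val_isUnit (a x)).ne_zero

end HyperplaneSparse

section Equidistribution

variable {ι : Type*} {p : ℕ} {V : Type*} [AddCommGroup V] [Module (ZMod p) V]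

/-- The character `t ↦ χ (t • v)` of `ZMod p` that `χ` induces on the line spanned by `v`. -/
def lineChar (χ : AddChar V ℂ) (v : V) : AddChar (ZMod p) ℂ :=
  χ.compAddMonoidHom (LinearMap.toSpanSingleton (ZMod p) V v).toAddMonoidHom

lemma lineChar_apply (χ : AddChar V ℂ) (v : V) (t : ZMod p) : lineChar χ v t = χ (t • v) := rfl

lemma injOn_natCast_range {J : ℕ} (hJ : J ≤ p) : Set.InjOn ((↑) : ℕ → ZMod p) (range J) :=
  (CharP.natCast_injOn_Iio (ZMod p) p).mono fun _ hj => (mem_range.1 hj).trans_le hJ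

lemma charSum_image_natCast_lineChar {J : ℕ} (hJ : J ≤ p) (χ : AddChar V ℂ) (v : V) :
    charSum ((range J).image ((↑) : ℕ → ZMod p)) (lineChar χ v) = ∑ j ∈ range J, χ (j • v) := by
  rw [charSum, sum_image (injOn_natCast_range hJ)]
  simp only [lineChar_apply, Nat.cast_smul_eq_nsmul]

variable [Fact p.Prime] {a : ι → V} {S : Finset ι} {K : ℝ}

lemma HyperplaneSparse.sum_norm_charSum_lineChar_sq_le (h : HyperplaneSparse p a S K)
    {χ : AddChar V ℂ} (hχ : χ ≠ 0) (Y : Finset (ZMod p)) :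
    ∑ i ∈ S, ‖charSum Y (lineChar χ (a i))‖ ^ 2 ≤ K * (p * #Y) := by
  classical
  have hfiber : ∀ ξ : AddChar (ZMod p) ℂ, (#{i ∈ S | lineChar χ (a i) = ξ} : ℝ) ≤ K := fun ξ =>
    (Nat.cast_le.2 (card_le_card (monotone_filter_right S fun i _ hi => by
      rw [← hi, lineChar_apply (p := p), one_smul]))).trans (h.card_addChar_fiber_le hχ (ξ 1))
  calc ∑ i ∈ S, ‖charSum Y (lineChar χ (a i))‖ ^ 2
      = ∑ ξ, #{i ∈ S | lineChar χ (a i) = ξ} * ‖charSum Y ξ‖ ^ 2 := by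
        rw [← sum_fiberwise S fun i => lineChar (p := p) χ (a i)]
        refine sum_congr rfl fun ξ _ => ?_
        rw [← nsmul_eq_mul, ← sum_const]
        exact sum_congr rfl fun i hi => by rw [(mem_filter.1 hi).2]
    _ ≤ ∑ ξ, K * ‖charSum Y ξ‖ ^ 2 := sum_le_sum fun ξ _ => by gcongr; exact hfiber ξ
    _ = K * (p * #Y) := by rw [← mul_sum, sum_norm_charSum_sq, ZMod.card]

lemma HyperplaneSparse.sum_re_addChar_le (h : HyperplaneSparse p a S K) {χ : AddChar V ℂ}
    (hχ : χ ≠ 0) {J : ℕ} (hJ : J ≤ p) (hKJ : 4 * p * K ≤ J * #S) :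
    ∑ i ∈ S, ∑ j ∈ range J, (χ (j • a i)).re ≤ #S * J / 2 := by
  set Y : Finset (ZMod p) := (range J).image (↑) with hY
  have hcard : #Y = J := by rw [hY, card_image_of_injOn (injOn_natCast_range hJ), card_range]
  have hsq : (∑ i ∈ S, ‖charSum Y (lineChar χ (a i))‖) ^ 2 ≤ (#S * J / 2 : ℝ) ^ 2 :=
    calc (∑ i ∈ S, ‖charSum Y (lineChar χ (a i))‖) ^ 2
        ≤ #S * ∑ i ∈ S, ‖charSum Y (lineChar χ (a i))‖ ^ 2 := sq_sum_le_card_mul_sum_sq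
      _ ≤ #S * (K * (p * J)) := by
          gcongr
          exact (h.sum_norm_charSum_lineChar_sq_le hχ Y).trans_eq (by rw [hcard])
      _ = #S * J * (4 * p * K) / 4 := by ring
      _ ≤ #S * J * (J * #S) / 4 := by gcongr
      _ = (#S * J / 2 : ℝ) ^ 2 := by ring
  calc ∑ i ∈ S, ∑ j ∈ range J, (χ (j • a i)).re
      = ∑ i ∈ S, (charSum Y (lineChar χ (a i))).re := by
        simp only [hY, charSum_image_natCast_lineChar hJ, Complex.re_sum]
    _ ≤ ∑ i ∈ S, ‖charSum Y (lineChar χ (a i))‖ := sum_le_sum fun i _ => Complex.re_le_norm _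
    _ ≤ #S * J / 2 := le_of_sq_le_sq hsq (by positivity)

lemma HyperplaneSparse.exists_le_outflow [Fintype V] [DecidableEq V]
    (h : HyperplaneSparse p a S K) (hS : S.Nonempty) {J : ℕ} (hJ₀ : 0 < J) (hJ : J ≤ p)
    (hKJ : 4 * p * K ≤ J * #S) {Y : Finset V} (hY : 2 * #Y ≤ Fintype.card V) :
    ∃ i ∈ S, #Y ≤ 4 * J * outflow Y (a i) := by
  have hgap : ∀ χ : AddChar V ℂ, χ ≠ 0 →
      (#S * J / 2 : ℝ) ≤ ∑ k ∈ S ×ˢ range J, (1 - (χ (k.2 • a k.1)).re) := by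
    intro χ hχ
    have hre := h.sum_re_addChar_le hχ hJ hKJ
    rw [sum_product]
    simp only [sum_sub_distrib, sum_const, card_range, nsmul_eq_mul, mul_one]
    linarith
  have hsum : ∑ k ∈ S ×ˢ range J, outflow Y (k.2 • a k.1) ≤ ∑ i ∈ S, J * (J * outflow Y (a i)) := by
    rw [sum_product]
    refine sum_le_sum fun i _ => ?_
    refine (sum_le_card_nsmul _ _ (J * outflow Y (a i)) fun j hj => ?_).trans (by simp)
    exact (outflow_nsmul_le _ _ _).trans (Nat.mul_le_mul_right _ (mem_range.1 hj).le)
  have hpoincare : #S * J / 2 * (#Y : ℝ) ≤ 2 * ∑ i ∈ S, (J * (J * outflow Y (a i)) : ℝ) :=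
    (mul_card_le_two_mul_sum_outflow hgap (by positivity) hY).trans
      (by gcongr; exact_mod_cast hsum)
  refine exists_le_of_sum_le hS ?_
  have hJ₀' : (0 : ℝ) < J := by exact_mod_cast hJ₀
  have : (∑ _i ∈ S, #Y : ℝ) ≤ ∑ i ∈ S, (4 * J * outflow Y (a i) : ℝ) := by
    simp only [sum_const, nsmul_eq_mul, ← mul_sum] at hpoincare ⊢
    refine le_of_mul_le_mul_left ?_ hJ₀'
    linarith
  exact_mod_cast this

lemma HyperplaneSparse.exists_le_outflow_sub [Fintype V] [DecidableEq V]
    (h : HyperplaneSparse p a S K) (hS : S.Nonempty) {J : ℕ} (hJ₀ : 0 < J) (hJ : J ≤ p)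
    (hKJ : 4 * p * K ≤ J * #S) {Y : Finset V} (hY : 2 * #Y ≤ Fintype.card V) :
    ∃ x ∈ S, ∃ y ∈ S, #Y ≤ 4 * J * outflow Y (a y - a x) := by
  obtain ⟨x, hx⟩ := hS
  exact ⟨x, hx, (h.sub_const (a x)).exists_le_outflow ⟨x, hx⟩ hJ₀ hJ hKJ hY⟩

end Equidistribution

section SubsetSums

variable {ι G : Type*} [AddCommGroup G]

/-- The set of all sums of `m` of the vectors `a i`, `i ∈ I`, with distinct indices. -/
def subsetSums [DecidableEq G] (a : ι → G) (m : ℕ) (I : Finset ι) : Finset G :=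
  (I.powersetCard m).image fun T => ∑ i ∈ T, a i

/-- For some `m ≤ M` there are `2m` indices in `S` such that every element of `G` is a sum of
exactly `m` of the corresponding vectors. Taking half of the indices makes the number of summands
independent of the element represented. -/
def HasFullHalfSums (a : ι → G) (S : Finset ι) (M : ℝ) : Prop :=
  ∃ I ⊆ S, ∃ m : ℕ, m ≤ M ∧ #I = 2 * m ∧ ∀ v, ∃ T ⊆ I, #T = m ∧ ∑ i ∈ T, a i = v

lemma HasFullHalfSums.mono {a : ι → G} {S S' : Finset ι} {M M' : ℝ} (h : HasFullHalfSums a S M)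
    (hS : S ⊆ S') (hM : M ≤ M') : HasFullHalfSums a S' M' := by
  obtain ⟨I, hIS, m, hm, hcard, hfull⟩ := h
  exact ⟨I, hIS.trans hS, m, hm.trans hM, hcard, hfull⟩

variable [DecidableEq G] {a : ι → G}

lemma mem_subsetSums {m : ℕ} {I : Finset ι} {v : G} :
    v ∈ subsetSums a m I ↔ ∃ T ⊆ I, #T = m ∧ ∑ i ∈ T, a i = v := by
  simp only [subsetSums, mem_image, mem_powersetCard, and_assoc]

lemma card_subsetSums_add_outflow_le [DecidableEq ι] {m : ℕ} {I : Finset ι} {x y : ι}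
    (hx : x ∉ I) (hy : y ∉ I) :
    #(subsetSums a m I) + outflow (subsetSums a m I) (a y - a x) ≤
      #(subsetSums a (m + 1) (insert x (insert y I))) := by
  rw [← card_union_vadd, ← card_vadd_finset (a x), vadd_finset_union, vadd_vadd, add_sub_cancel]
  have hinsert : ∀ z ∉ I, z ∈ ({x, y} : Finset ι) →
      a z +ᵥ subsetSums a m I ⊆ subsetSums a (m + 1) (insert x (insert y I)) := by
    intro z hz hzxy w hw
    obtain ⟨v, hv, rfl⟩ := mem_vadd_finset.1 hw
    obtain ⟨T, hTI, hTm, rfl⟩ := mem_subsetSums.1 hv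
    have hzT : z ∉ T := fun h => hz (hTI h)
    refine mem_subsetSums.2 ⟨insert z T, ?_, by rw [card_insert_of_notMem hzT, hTm], ?_⟩
    · grind
    · rw [sum_insert hzT, vadd_eq_add]
  exact card_le_card (union_subset (hinsert x hx (by simp)) (hinsert y hy (by simp)))

lemma exists_sum_eq_of_card_lt [Fintype G] [DecidableEq ι] {I₁ I₂ : Finset ι} {m₁ m₂ : ℕ}
    (hI : Disjoint I₁ I₂)
    (h : Fintype.card G < #(subsetSums a m₁ I₁) + #(subsetSums a m₂ I₂)) (v : G) :
    ∃ T ⊆ I₁ ∪ I₂, #T = m₁ + m₂ ∧ ∑ i ∈ T, a i = v := by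
  have hcard : #((subsetSums a m₂ I₂).image (v - ·)) = #(subsetSums a m₂ I₂) :=
    card_image_of_injective _ sub_right_injective
  obtain ⟨w, hw⟩ := inter_nonempty_of_card_lt_card_add_card (subset_univ (subsetSums a m₁ I₁))
    (subset_univ ((subsetSums a m₂ I₂).image (v - ·))) (by rwa [hcard, card_univ])
  obtain ⟨hw₁, hw₂⟩ := mem_inter.1 hw
  obtain ⟨u, hu, rfl⟩ := mem_image.1 hw₂
  obtain ⟨T₁, hT₁, rfl, hsum₁⟩ := mem_subsetSums.1 hw₁
  obtain ⟨T₂, hT₂, rfl, hsum₂⟩ := mem_subsetSums.1 hu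
  have hT : Disjoint T₁ T₂ := hI.mono hT₁ hT₂
  refine ⟨T₁ ∪ T₂, union_subset_union hT₁ hT₂, card_union_of_disjoint hT, ?_⟩
  rw [sum_union hT, hsum₁, hsum₂, sub_add_cancel]

lemma exists_subsetSums_greedy [Fintype G] {S I₀ : Finset ι} {m₀ : ℕ} (f : ℕ → ℝ) (k : ℕ)
    (hI₀ : I₀ ⊆ S) (hm₀ : #I₀ = 2 * m₀) (hf : f 0 ≤ #(subsetSums a m₀ I₀))
    (hstep : ∀ n < k, ∀ Y : Finset G, f n ≤ #Y → 2 * #Y ≤ Fintype.card G →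
      ∀ S' ⊆ S, #S ≤ #S' + 2 * (m₀ + n) →
        ∃ x ∈ S', ∃ y ∈ S', f (n + 1) ≤ #Y + outflow Y (a y - a x)) :
    ∃ I ⊆ S, ∃ m ≤ m₀ + k, #I = 2 * m ∧
      (Fintype.card G < 2 * #(subsetSums a m I) ∨ f k ≤ #(subsetSums a m I)) := by
  classical
  induction k with
  | zero => exact ⟨I₀, hI₀, m₀, le_rfl, hm₀, Or.inr hf⟩
  | succ k ih =>
    obtain ⟨I, hIS, m, hm, hcard, hlarge⟩ := ih fun n hn => hstep n (hn.trans k.lt_succ_self)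
    by_cases hhalf : Fintype.card G < 2 * #(subsetSums a m I)
    · exact ⟨I, hIS, m, by omega, hcard, Or.inl hhalf⟩
    obtain ⟨x, hx, y, hy, hxy⟩ := hstep k k.lt_succ_self _ (hlarge.resolve_left hhalf)
      (not_lt.1 hhalf) (S \ I) sdiff_subset (by rw [card_sdiff_of_subset hIS]; omega)
    obtain rfl | hne := eq_or_ne x y
    · rw [sub_self, outflow_zero, Nat.cast_zero, add_zero] at hxy
      exact ⟨I, hIS, m, by omega, hcard, Or.inr hxy⟩
    obtain ⟨hxS, hxI⟩ := mem_sdiff.1 hx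
    obtain ⟨hyS, hyI⟩ := mem_sdiff.1 hy
    refine ⟨insert x (insert y I), insert_subset hxS (insert_subset hyS hIS), m + 1, by omega, ?_,
      Or.inr (hxy.trans ?_)⟩
    · rw [card_insert_of_notMem (by simp [hne, hxI]), card_insert_of_notMem hyI]
      omega
    · exact_mod_cast card_subsetSums_add_outflow_le hxI hyI

end SubsetSums

section Expansion

variable {ι : Type*} {p : ℕ} [Fact p.Prime] {V : Type*} [AddCommGroup V] [Module (ZMod p) V]
  [Fintype V] [DecidableEq V] {a : ι → V} {S : Finset ι} {K : ℝ}

/-- An isoperimetric property of `V`: some vector of any basis increases the `d`-th root of the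
cardinality of a set by at least `c`, as long as that set fills at most half of `V`. -/
def ExpandsAlongBases (p : ℕ) (V : Type*) [AddCommGroup V] [Module (ZMod p) V] [Fintype V]
    [DecidableEq V] (d : ℕ) (c : ℝ) : Prop :=
  ∀ (b : Basis (Fin d) (ZMod p) V) (Y : Finset V) (x : ℝ), c ≤ x → x ^ d ≤ #Y →
    2 * #Y ≤ Fintype.card V → ∃ j, (x + c) ^ d ≤ #Y + outflow Y (b j)

lemma ExpandsAlongBases.exists_pow_le_card_subsetSums {d : ℕ} {c : ℝ}
    (hV : ExpandsAlongBases p V d c) (hd : finrank (ZMod p) V = d) (hc₀ : 0 ≤ c) (hc₁ : c ≤ 1)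
    (h : HyperplaneSparse p a S K) (hK : 0 ≤ K) {k : ℕ} (hk : K + 2 * k ≤ #S) :
    ∃ I ⊆ S, ∃ m ≤ k, #I = 2 * m ∧ (Fintype.card V < 2 * #(subsetSums a m I) ∨
      (c * (k + 1)) ^ d ≤ #(subsetSums a m I)) := by
  subst hd
  have hgreedy := exists_subsetSums_greedy (a := a) (S := S) (I₀ := ∅) (m₀ := 0)
    (fun n => (c * (n + 1)) ^ finrank (ZMod p) V) k (empty_subset S) rfl ?_ ?_
  · simpa only [zero_add] using hgreedy
  · simpa [subsetSums] using pow_le_one₀ hc₀ hc₁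
  · intro n hn Y hY hhalf S' hS' hcard
    have hKS' : K < #S' := by
      have hcard' : (#S : ℝ) ≤ #S' + 2 * (0 + n) := by exact_mod_cast hcard
      have hn' : (n + 1 : ℝ) ≤ k := by exact_mod_cast hn
      linarith
    obtain ⟨x, hx⟩ : S'.Nonempty := card_pos.1 (Nat.cast_pos.1 (hK.trans_lt hKS'))
    obtain ⟨b, hb⟩ := (h.mono hS').exists_basis_sub hKS' x
    obtain ⟨j, hj⟩ := hV b Y _ (le_mul_of_one_le_right hc₀ (by simp)) hY hhalf
    obtain ⟨y, hy, hby⟩ := hb j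
    refine ⟨x, hx, y, hy, ?_⟩
    rw [← hby]
    convert hj using 2
    push_cast
    ring

lemma HyperplaneSparse.exists_mul_le_card_subsetSums (h : HyperplaneSparse p a S K)
    {I₀ : Finset ι} {m₀ k J : ℕ} (hI₀ : I₀ ⊆ S) (hm₀ : #I₀ = 2 * m₀) (hJ₀ : 0 < J) (hJ : J ≤ p)
    (hk : 2 * (m₀ + k) < #S) (hKJ : 4 * p * K ≤ J * (#S - 2 * (m₀ + k))) :
    ∃ I ⊆ S, ∃ m ≤ m₀ + k, #I = 2 * m ∧ (Fintype.card V < 2 * #(subsetSums a m I) ∨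
      #(subsetSums a m₀ I₀) * (1 + k / (4 * J) : ℝ) ≤ #(subsetSums a m I)) := by
  refine exists_subsetSums_greedy (fun n => #(subsetSums a m₀ I₀) * (1 + n / (4 * J) : ℝ)) k
    hI₀ hm₀ (by simp) ?_
  intro n hn Y hY hhalf S' hS' hcard
  have hS'₀ : S'.Nonempty := card_pos.1 (by omega)
  have hKJ' : 4 * p * K ≤ J * #S' := by
    have hcard' : (#S : ℝ) ≤ #S' + 2 * (m₀ + k) := by
      have : #S ≤ #S' + 2 * (m₀ + k) := by omega
      exact_mod_cast this
    exact hKJ.trans (by gcongr; linarith)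
  obtain ⟨x, hx, y, hy, hxy⟩ := (h.mono hS').exists_le_outflow_sub hS'₀ hJ₀ hJ hKJ' hhalf
  refine ⟨x, hx, y, hy, ?_⟩
  have hxy' : (#Y : ℝ) ≤ 4 * J * outflow Y (a y - a x) := by exact_mod_cast hxy
  have hbase : (#(subsetSums a m₀ I₀) : ℝ) ≤ #Y :=
    (le_mul_of_one_le_right (by positivity) (le_add_of_nonneg_right (by positivity))).trans hY
  calc #(subsetSums a m₀ I₀) * (1 + (n + 1 : ℕ) / (4 * J) : ℝ)
      = #(subsetSums a m₀ I₀) * (1 + n / (4 * J) : ℝ) + #(subsetSums a m₀ I₀) / (4 * J) := by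
        push_cast; ring
    _ ≤ #Y + outflow Y (a y - a x) := by
        gcongr
        rw [div_le_iff₀ (by positivity)]
        linarith

lemma ExpandsAlongBases.exists_card_lt_two_mul_card_subsetSums {d : ℕ} {c γ : ℝ}
    (hV : ExpandsAlongBases p V d c) (hd : finrank (ZMod p) V = d) (hc₀ : 0 ≤ c) (hc₁ : c ≤ 1)
    (h : HyperplaneSparse p a S K) (hK : 0 ≤ K) {k J : ℕ} (hJ₀ : 0 < J) (hJ : J ≤ p)
    (hk : K + 4 * k < #S) (hKJ : 4 * p * K ≤ J * (#S - 4 * k))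
    (hγ : γ * p ^ d < (c * (k + 1)) ^ d) (hγJ : 2 * J ≤ γ * k) :
    ∃ I ⊆ S, ∃ m ≤ 2 * k, #I = 2 * m ∧ Fintype.card V < 2 * #(subsetSums a m I) := by
  obtain ⟨I₀, hI₀, m₀, hm₀, hcard₀, hlarge₀⟩ :=
    hV.exists_pow_le_card_subsetSums hd hc₀ hc₁ h hK (k := k) (by
      have : (0 : ℝ) ≤ k := k.cast_nonneg
      linarith)
  obtain hhalf | hseed := hlarge₀
  · exact ⟨I₀, hI₀, m₀, by omega, hcard₀, hhalf⟩
  have hm₀' : (m₀ : ℝ) ≤ k := by exact_mod_cast hm₀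
  have hkS : 4 * k < #S := by
    have : (4 * k : ℝ) < #S := by linarith
    exact_mod_cast this
  obtain ⟨I, hI, m, hm, hcard, hlarge⟩ := h.exists_mul_le_card_subsetSums hI₀ hcard₀ hJ₀ hJ
    (k := k) (by omega) (hKJ.trans (mul_le_mul_of_nonneg_left (by linarith) J.cast_nonneg))
  refine ⟨I, hI, m, by omega, hcard, hlarge.elim id fun hexpand => ?_⟩
  have hcardV : (Fintype.card V : ℝ) = p ^ d := by
    rw [← hd, Module.card_eq_pow_finrank (K := ZMod p), ZMod.card]
    exact Nat.cast_pow _ _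
  have hJ₀' : (0 : ℝ) < J := by exact_mod_cast hJ₀
  have hγ₀ : 0 < γ := pos_of_mul_pos_left (by linarith) k.cast_nonneg
  have hp : (0 : ℝ) < p ^ d := by exact_mod_cast pow_pos (Fact.out : p.Prime).pos d
  have hlt : (Fintype.card V : ℝ) < 2 * #(subsetSums a m I) :=
    calc (Fintype.card V : ℝ) = 2 * (p ^ d * (1 / 2)) := by rw [hcardV]; ring
      _ ≤ 2 * (p ^ d * (γ * (k / (4 * J)))) := by
          gcongr
          rw [← mul_div_assoc, le_div_iff₀ (by positivity)]
          linarith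
      _ = 2 * (γ * p ^ d * (k / (4 * J))) := by ring
      _ < 2 * (γ * p ^ d * (1 + k / (4 * J))) := by gcongr; exact lt_one_add _
      _ ≤ 2 * ((c * (k + 1)) ^ d * (1 + k / (4 * J))) := by gcongr
      _ ≤ 2 * (#(subsetSums a m₀ I₀) * (1 + k / (4 * J))) := by gcongr
      _ ≤ 2 * #(subsetSums a m I) := by gcongr
  exact_mod_cast hlt

lemma exists_phase_lengths {η θ γ δ : ℝ} {p : ℕ} (hη : 0 < η) (hγ : 0 < γ) (hδ : 0 < δ)
    (hδp : 1 ≤ δ * p) (hδη : 8 * δ ≤ η) (hδθ : 4 * δ ≤ θ) (hδγ : δ * (8 * (η + 8)) ≤ θ * γ * η) :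
    ∃ k J : ℕ, 0 < J ∧ J ≤ p ∧ 8 * δ * p ≤ J * η ∧ k ≤ θ * p / 2 ∧ θ * p / 2 < k + 1 ∧
      2 * J ≤ γ * k := by
  have hp : (0 : ℝ) < p := pos_of_mul_pos_right (one_pos.trans_le hδp) hδ.le
  have hδθp : 4 * δ * p ≤ θ * p := mul_le_mul_of_nonneg_right hδθ hp.le
  set k : ℕ := ⌊θ * p / 2⌋₊
  set J : ℕ := ⌈8 * δ * p / η⌉₊
  have hk : k ≤ θ * p / 2 := Nat.floor_le (by linarith)
  have hk' : θ * p / 2 < k + 1 := Nat.lt_floor_add_one _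
  have hJη : J * η ≤ 8 * δ * p + η := by
    have hlt : J < 8 * δ * p / η + 1 := Nat.ceil_lt_add_one (by positivity)
    rw [← sub_lt_iff_lt_add, lt_div_iff₀ hη] at hlt
    linarith
  have hJγ : 8 * J ≤ γ * (θ * p) := by
    refine le_of_mul_le_mul_right ?_ hη
    linarith [mul_le_mul_of_nonneg_left hδp hη.le, mul_le_mul_of_nonneg_right hδγ hp.le]
  refine ⟨k, J, Nat.ceil_pos.2 (by positivity), Nat.ceil_le.2 ?_,
    (div_le_iff₀ hη).1 (Nat.le_ceil _), hk, hk', ?_⟩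
  · rw [div_le_iff₀ hη, mul_comm (p : ℝ)]
    gcongr
  · have hkθ : θ * p / 4 ≤ k := by linarith
    linarith [mul_le_mul_of_nonneg_left hkθ hγ.le]

theorem exists_delta_card_lt_two_mul_card_subsetSums {η θ c : ℝ} (hη : 0 < η) (hθ : 0 < θ)
    (hθη : 4 * θ ≤ η) (hc₀ : 0 < c) (hc₁ : c ≤ 1) {d : ℕ} (hd₀ : 0 < d) :
    ∃ δ : ℝ, 0 < δ ∧ ∀ (p : ℕ) [Fact p.Prime] (V : Type u) [AddCommGroup V] [Module (ZMod p) V]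
      [Fintype V] [DecidableEq V], finrank (ZMod p) V = d → ExpandsAlongBases p V d c →
      ∀ (ι : Type v) (a : ι → V) (S : Finset ι), η * p ≤ #S → HyperplaneSparse p a S (δ * p) →
        ∃ I ⊆ S, ∃ m : ℕ, m ≤ θ * p ∧ #I = 2 * m ∧ Fintype.card V < 2 * #(subsetSums a m I) := by
  -- The first phase produces a set of sums of density more than `γ` in `V`.
  set γ : ℝ := (c * (θ / 2)) ^ d with hγ
  have hγ₀ : 0 < γ := by positivity
  obtain ⟨δ, hδ₀, hδη, hδθ, hδγ⟩ :
      ∃ δ : ℝ, 0 < δ ∧ 8 * δ ≤ η ∧ 4 * δ ≤ θ ∧ δ * (8 * (η + 8)) ≤ θ * γ * η := by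
    refine ⟨min (η / 8) (min (θ / 4) (θ * γ * η / (8 * (η + 8)))), by positivity, ?_, ?_, ?_⟩
    · linarith [min_le_left (η / 8) (min (θ / 4) (θ * γ * η / (8 * (η + 8))))]
    · rw [mul_comm, ← le_div_iff₀ four_pos]
      exact (min_le_right _ _).trans (min_le_left _ _)
    · rw [← le_div_iff₀ (by positivity)]
      exact (min_le_right _ _).trans (min_le_right _ _)
  refine ⟨δ, hδ₀, fun p _ V _ _ _ _ hd hV ι a S hS hsparse => ?_⟩
  have hp : (0 : ℝ) < p := by exact_mod_cast (Fact.out : p.Prime).pos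
  have hδp : 1 ≤ δ * p := by
    have : Nontrivial V := Module.nontrivial_of_finrank_pos (R := ZMod p) (hd ▸ hd₀)
    exact hsparse.one_le (card_pos.1 (Nat.cast_pos.1 ((mul_pos hη hp).trans_le hS)))
  obtain ⟨k, J, hJ₀, hJp, hJη, hk, hk', hγJ⟩ := exists_phase_lengths hη hγ₀ hδ₀ hδp hδη hδθ hδγ
  have hrest : η * p / 2 ≤ #S - 4 * k := by nlinarith
  have hKJ : 4 * p * (δ * p) ≤ J * (#S - 4 * k) :=
    calc 4 * p * (δ * p) = 8 * δ * p * (p / 2) := by ring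
      _ ≤ J * η * (p / 2) := by gcongr
      _ = J * (η * p / 2) := by ring
      _ ≤ J * (#S - 4 * k) := by gcongr
  have hseed : γ * p ^ d < (c * (k + 1)) ^ d := by
    rw [hγ, ← mul_pow]
    refine pow_lt_pow_left₀ ?_ (by positivity) hd₀.ne'
    linarith [mul_lt_mul_of_pos_left hk' hc₀]
  obtain ⟨I, hI, m, hm, hcard, hhalf⟩ := hV.exists_card_lt_two_mul_card_subsetSums hd hc₀.le hc₁
    hsparse (by positivity) hJ₀ hJp (by nlinarith) hKJ hseed hγJ
  have hm' : (m : ℝ) ≤ 2 * k := by exact_mod_cast hm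
  exact ⟨I, hI, m, by linarith, hcard, hhalf⟩

theorem exists_delta_hasFullHalfSums {η θ c : ℝ} (hη : 0 < η) (hθ : 0 < θ) (hc₀ : 0 < c)
    (hc₁ : c ≤ 1) {d : ℕ} (hd₀ : 0 < d) :
    ∃ δ : ℝ, 0 < δ ∧ ∀ (p : ℕ) [Fact p.Prime] (V : Type u) [AddCommGroup V] [Module (ZMod p) V]
      [Fintype V] [DecidableEq V], finrank (ZMod p) V = d → ExpandsAlongBases p V d c →
      ∀ (ι : Type v) (a : ι → V) (S : Finset ι), η * p ≤ #S → HyperplaneSparse p a S (δ * p) →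
        HasFullHalfSums a S (θ * p) := by
  classical
  obtain ⟨δ, hδ, hlarge⟩ := exists_delta_card_lt_two_mul_card_subsetSums (η := η / 2)
    (θ := min (θ / 2) (η / 8)) (by positivity) (by positivity)
    (by linarith [min_le_right (θ / 2) (η / 8)]) hc₀ hc₁ hd₀
  refine ⟨δ, hδ, fun p _ V _ _ _ _ hd hV ι a S hS hsparse => ?_⟩
  have hp : (0 : ℝ) < p := by exact_mod_cast (Fact.out : p.Prime).pos
  have hηp : 0 < η * p := by positivity
  obtain ⟨I₁, hI₁, m₁, hm₁, hcard₁, hhalf₁⟩ := hlarge p V hd hV ι a S (by linarith) hsparse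
  have hrest : η / 2 * p ≤ #(S \ I₁) := by
    have hsplit : (#(S \ I₁) + #I₁ : ℝ) = #S := by
      exact_mod_cast card_sdiff_add_card_eq_card hI₁
    have hI₁' : (#I₁ : ℝ) = 2 * m₁ := by exact_mod_cast hcard₁
    nlinarith [min_le_right (θ / 2) (η / 8)]
  obtain ⟨I₂, hI₂, m₂, hm₂, hcard₂, hhalf₂⟩ :=
    hlarge p V hd hV ι a (S \ I₁) hrest (hsparse.mono sdiff_subset)
  have hdisj : Disjoint I₁ I₂ := disjoint_of_subset_right hI₂ disjoint_sdiff
  refine ⟨I₁ ∪ I₂, union_subset hI₁ (hI₂.trans sdiff_subset), m₁ + m₂, ?_, ?_,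
    exists_sum_eq_of_card_lt hdisj (by omega)⟩
  · push_cast
    nlinarith [min_le_left (θ / 2) (η / 8)]
  · rw [card_union_of_disjoint hdisj, hcard₁, hcard₂, mul_add]

end Expansion

section Isoperimetry

variable {G β : Type*} [AddCommGroup G] [DecidableEq G] {Y : Finset G} {d : G}

lemma add_nsmul_mem_of_outflow_eq_zero (h : outflow Y d = 0) {y : G} (hy : y ∈ Y) (j : ℕ) :
    y + j • d ∈ Y := by
  have hsub : d +ᵥ Y ⊆ Y := sdiff_eq_empty_iff_subset.1 (card_eq_zero.1 h)
  induction j with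
  | zero => rwa [zero_nsmul, add_zero]
  | succ j ih =>
    rw [succ_nsmul', add_left_comm, ← vadd_eq_add]
    exact hsub (vadd_mem_vadd_finset ih)

lemma addOrderOf_le_card_of_outflow_eq_zero (hY : Y.Nonempty) (h : outflow Y d = 0) :
    addOrderOf d ≤ #Y := by
  obtain ⟨y, hy⟩ := hY
  rw [← card_range (addOrderOf d)]
  refine card_le_card_of_injOn (fun j => y + j • d)
    (fun j _ => add_nsmul_mem_of_outflow_eq_zero h hy j) fun i hi j hj hij => ?_
  exact nsmul_injOn_Iio_addOrderOf (mem_range.1 hi) (mem_range.1 hj) (add_left_cancel hij)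

variable [DecidableEq β] {f : G → β}

lemma sum_outflow_fiber (hf : ∀ y, f (d + y) = f y) (Y : Finset G) :
    ∑ z ∈ Y.image f, outflow {y ∈ Y | f y = z} d = outflow Y d := by
  have hmaps : ∀ w ∈ (d +ᵥ Y) \ Y, f w ∈ Y.image f := by
    intro w hw
    obtain ⟨y, hy, rfl⟩ := mem_vadd_finset.1 (mem_sdiff.1 hw).1
    exact mem_image.2 ⟨y, hy, (hf y).symm⟩
  rw [outflow, card_eq_sum_card_fiberwise hmaps]
  refine sum_congr rfl fun z _ => congrArg card ?_
  ext w
  simp only [mem_sdiff, mem_filter, mem_vadd_finset, vadd_eq_add]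
  grind

lemma card_image_mul_addOrderOf_le (hf : ∀ y, f (d + y) = f y) (Y : Finset G) :
    #(Y.image f) * addOrderOf d ≤ addOrderOf d * outflow Y d + #Y := by
  have hfiber : ∀ z ∈ Y.image f,
      addOrderOf d ≤ addOrderOf d * outflow {y ∈ Y | f y = z} d + #{y ∈ Y | f y = z} := by
    intro z hz
    obtain h | h := Nat.eq_zero_or_pos (outflow {y ∈ Y | f y = z} d)
    · exact (addOrderOf_le_card_of_outflow_eq_zero (fiber_nonempty_iff_mem_image.2 hz) h).trans
        (Nat.le_add_left _ _)
    · exact (Nat.le_mul_of_pos_right _ h).trans (Nat.le_add_right _ _)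
  calc #(Y.image f) * addOrderOf d = ∑ _z ∈ Y.image f, addOrderOf d := by
        rw [sum_const, smul_eq_mul]
    _ ≤ ∑ z ∈ Y.image f, (addOrderOf d * outflow {y ∈ Y | f y = z} d + #{y ∈ Y | f y = z}) :=
        sum_le_sum hfiber
    _ = addOrderOf d * outflow Y d + #Y := by
        rw [sum_add_distrib, ← mul_sum, sum_outflow_fiber hf, ← card_eq_sum_card_image]

variable {p : ℕ} [Fact p.Prime] {V : Type*} [AddCommGroup V] [Module (ZMod p) V]

lemma addOrderOf_basis {κ : Type*} (b : Basis κ (ZMod p) V) (j : κ) : addOrderOf (b j) = p :=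
  addOrderOf_eq_prime (by rw [← Nat.cast_smul_eq_nsmul (ZMod p), ZMod.natCast_self, zero_smul])
    (b.ne_zero j)

variable [Fintype V] [DecidableEq V]

lemma expandsAlongBases_one : ExpandsAlongBases p V 1 1 := by
  intro b Y x hx hxY hY
  have hYcard : 0 < #Y := Nat.cast_pos.1 ((pow_pos (one_pos.trans_le hx) 1).trans_le hxY)
  have hcard : Fintype.card V = p := by simpa using Module.card_fintype b
  have hout : 1 ≤ outflow Y (b 0) := by
    by_contra! h
    have hle := addOrderOf_le_card_of_outflow_eq_zero (card_pos.1 hYcard) (Nat.lt_one_iff.1 h)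
    rw [addOrderOf_basis] at hle
    omega
  have hout' : (1 : ℝ) ≤ outflow Y (b 0) := by exact_mod_cast hout
  exact ⟨0, by rw [pow_one] at *; exact add_le_add hxY hout'⟩

lemma exists_card_le_card_image_coord_sq {R M : Type*} [CommRing R] [DecidableEq R]
    [AddCommGroup M] [Module R M] (b : Basis (Fin 2) R M) (Y : Finset M) :
    ∃ i j, i ≠ j ∧ #Y ≤ #(Y.image (b.coord i)) ^ 2 := by
  have hmul : #Y ≤ #(Y.image (b.coord 0)) * #(Y.image (b.coord 1)) := by
    rw [← card_product]
    refine card_le_card_of_injOn (fun v => (b.coord 0 v, b.coord 1 v))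
      (fun v hv => mem_product.2 ⟨mem_image_of_mem _ hv, mem_image_of_mem _ hv⟩)
      fun v _ w _ hvw => b.ext_elem fun i => ?_
    obtain ⟨h₀, h₁⟩ := Prod.ext_iff.1 hvw
    fin_cases i
    exacts [h₀, h₁]
  obtain h | h := le_total (#(Y.image (b.coord 0))) (#(Y.image (b.coord 1)))
  · exact ⟨1, 0, by decide, hmul.trans (by rw [sq]; exact Nat.mul_le_mul_right _ h)⟩
  · exact ⟨0, 1, by decide, hmul.trans (by rw [sq]; exact Nat.mul_le_mul_left _ h)⟩

lemma exists_card_le_mul_outflow_sq (b : Basis (Fin 2) (ZMod p) V) {Y : Finset V}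
    (hY : 2 * #Y ≤ Fintype.card V) : ∃ j, #Y ≤ 16 * outflow Y (b j) ^ 2 := by
  obtain ⟨i, j, hij, hr⟩ := exists_card_le_card_image_coord_sq b Y
  set r := #(Y.image (b.coord i))
  have hcard : Fintype.card V = p ^ 2 := by simpa using Module.card_fintype b
  have hp : 0 < p := (Fact.out : p.Prime).pos
  have hrp : 4 * #Y ≤ 3 * (r * p) := by
    refine (Nat.pow_le_pow_iff_left two_ne_zero).1 ?_
    calc (4 * #Y) ^ 2 = 8 * (#Y * (2 * #Y)) := by ring
      _ ≤ 8 * (r ^ 2 * p ^ 2) := by gcongr; exact hY.trans_eq hcard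
      _ ≤ (3 * (r * p)) ^ 2 := by rw [mul_pow, mul_pow]; exact Nat.mul_le_mul_right _ (by norm_num)
  have hout : r * p ≤ p * outflow Y (b j) + #Y := by
    simpa only [addOrderOf_basis] using card_image_mul_addOrderOf_le (f := b.coord i) (d := b j)
      (fun y => by simp [hij.symm]) Y
  have hr4 : r ≤ 4 * outflow Y (b j) := by
    refine Nat.le_of_mul_le_mul_right ?_ hp
    linarith
  exact ⟨j, hr.trans ((Nat.pow_le_pow_left hr4 2).trans_eq (by ring))⟩

lemma expandsAlongBases_two : ExpandsAlongBases p V 2 (1 / 12) := by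
  intro b Y x hx hxY hY
  obtain ⟨j, hj⟩ := exists_card_le_mul_outflow_sq b hY
  have hj' : (#Y : ℝ) ≤ 16 * outflow Y (b j) ^ 2 := by exact_mod_cast hj
  have hx4 : x ≤ 4 * outflow Y (b j) := by
    refine le_of_sq_le_sq ?_ (by positivity)
    linarith
  refine ⟨j, ?_⟩
  calc (x + 1 / 12) ^ 2 = x ^ 2 + x / 6 + 1 / 12 * (1 / 12) := by ring
    _ ≤ (#Y + outflow Y (b j) : ℝ) := by linarith

end Isoperimetry

section Plane

variable {k V : Type*} [Field k] [AddCommGroup V] [Module k V] {φ ψ : Dual k V}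

lemma bijective_prod_of_linearIndependent (hV : finrank k V = 2)
    (h : LinearIndependent k ![φ, ψ]) : Function.Bijective (φ.prod ψ) := by
  have := finite_of_finrank_eq_succ hV
  have hspan : Submodule.span k {ψ, φ} = ⊤ := by
    simpa using h.span_eq_top_of_card_eq_finrank'
      (by rw [Fintype.card_fin, Subspace.dual_finrank_eq, hV])
  have hinj : Function.Injective (φ.prod ψ) := by
    refine (injective_iff_map_eq_zero _).2 fun v hv => ?_
    obtain ⟨hφ, hψ⟩ : φ v = 0 ∧ ψ v = 0 := Prod.mk.inj hv
    refine (forall_dual_apply_eq_zero_iff k v).1 fun f => ?_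
    obtain ⟨r, s, rfl⟩ := Submodule.mem_span_pair.1 (hspan ▸ Submodule.mem_top : f ∈ _)
    simp [hφ, hψ]
  exact ⟨hinj, (LinearMap.injective_iff_surjective_of_finrank_eq_finrank (by
    rw [hV, finrank_prod, finrank_self])).1 hinj⟩

lemma apply_eq_of_not_linearIndependent (hψ : ψ ≠ 0) (h : ¬LinearIndependent k ![φ, ψ]) {u v : V}
    (huv : ψ u = ψ v) : φ u = φ v := by
  rw [LinearIndependent.pair_symm_iff, LinearIndependent.pair_iff' hψ] at h
  push Not at h
  obtain ⟨r, rfl⟩ := h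
  simp only [LinearMap.smul_apply, huv]

lemma exists_linearIndependent_dual (hV : finrank k V = 2) (hφ : φ ≠ 0) :
    ∃ ψ : Dual k V, LinearIndependent k ![φ, ψ] :=
  exists_linearIndependent_pair_of_one_lt_finrank (by
    rw [Subspace.dual_finrank_eq, hV]; exact one_lt_two) hφ

variable {ι : Type*} [DecidableEq k] [DecidableEq V] {a : ι → V} {S : Finset ι} {K : ℝ}

lemma card_filter_and_le_of_linearIndependent (hV : finrank k V = 2)
    (h : LinearIndependent k ![φ, ψ]) (hmult : ∀ v, (#{i ∈ S | a i = v} : ℝ) ≤ K) (c d : k) :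
    (#{i ∈ S | φ (a i) = c ∧ ψ (a i) = d} : ℝ) ≤ K := by
  obtain ⟨v, hv⟩ := (bijective_prod_of_linearIndependent hV h).2 (c, d)
  refine le_trans (Nat.cast_le.2 (card_le_card ?_)) (hmult v)
  refine monotone_filter_right S fun i _ hi => ?_
  exact (bijective_prod_of_linearIndependent hV h).1 ((Prod.ext hi.1 hi.2).trans hv.symm)

end Plane

section Fibers

variable {ι k V W : Type*} [Ring k] [AddCommGroup V] [Module k V] [AddCommGroup W] [Module k W]

/-- The sums of exactly `m` of the `2m` vectors `a i`, `i ∈ I`, cover the fibre of `φ` over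
`m • c`, which is where they have to lie when `φ (a i) = c` for all `i ∈ I`. -/
def FillsFiber (a : ι → V) (φ : V →ₗ[k] W) (c : W) (m : ℕ) (I : Finset ι) : Prop :=
  #I = 2 * m ∧ ∀ v, φ v = m • c → ∃ T ⊆ I, #T = m ∧ ∑ i ∈ T, a i = v

/-- Subfamilies of `R` of size at least `N` that have sum zero modulo `ker φ` can be replaced by
subfamilies of `S` of the same size that have sum zero. -/
def LiftsZeroSums (a : ι → V) (φ : V →ₗ[k] W) (R S : Finset ι) (N : ℝ) : Prop :=
  ∀ B ⊆ R, ∑ i ∈ B, φ (a i) = 0 → N ≤ #B → ∃ B' ⊆ S, #B' = #B ∧ ∑ i ∈ B', a i = 0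

variable [DecidableEq ι] [DecidableEq W] {a : ι → V} {φ : V →ₗ[k] W} {c : W} {m : ℕ}
  {I : Finset ι}

lemma FillsFiber.exists_sum_eq_zero (h : FillsFiber a φ c m I) {B : Finset ι}
    (hIB : Disjoint I B) (hB : ∑ i ∈ B, φ (a i) = 0) (hm : m ≤ #{i ∈ B | φ (a i) = c}) :
    ∃ B' ⊆ I ∪ B, #B' = #B ∧ ∑ i ∈ B', a i = 0 := by
  obtain ⟨D, hD, hDm⟩ := exists_subset_card_eq hm
  have hDB : D ⊆ B := hD.trans (filter_subset _ _)
  have hφ : φ (∑ i ∈ D, a i - ∑ i ∈ B, a i) = m • c := by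
    rw [map_sub, map_sum, map_sum, hB, sub_zero,
      sum_congr rfl fun i hi => (mem_filter.1 (hD hi)).2, sum_const, hDm]
  obtain ⟨T, hT, hTm, hsum⟩ := h.2 _ hφ
  have hdisj : Disjoint T (B \ D) := hIB.mono hT sdiff_subset
  have hcard := card_sdiff_add_card_eq_card hDB
  refine ⟨T ∪ B \ D, union_subset_union hT sdiff_subset, ?_, ?_⟩
  · rw [card_union_of_disjoint hdisj]
    omega
  · rw [sum_union hdisj, hsum, ← sum_sdiff (f := a) hDB]
    abel

end Fibers

section Lines

variable {ι k V : Type*} [Field k] [AddCommGroup V] [Module k V] {a : ι → V} {S : Finset ι}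

/-- Any `N` of the vectors `a i`, `i ∈ S`, on a common affine hyperplane `φ = c` contain `2m` with
`m ≤ M` whose sums of length `m` cover the hyperplane `φ = m • c`. -/
def FillsLines (k : Type*) {V : Type*} [Field k] [AddCommGroup V] [Module k V] (a : ι → V)
    (S : Finset ι) (N M : ℝ) : Prop :=
  ∀ φ : Dual k V, φ ≠ 0 → ∀ c, ∀ L ⊆ S, (∀ i ∈ L, φ (a i) = c) → N ≤ #L →
    ∃ I ⊆ L, ∃ m : ℕ, m ≤ M ∧ FillsFiber a φ c m I

lemma FillsLines.mono {N N' M : ℝ} (h : FillsLines k a S N M) (hN : N ≤ N') :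
    FillsLines k a S N' M := fun φ hφ c L hLS hL hcard => h φ hφ c L hLS hL (hN.trans hcard)

lemma FillsFiber.hasFullHalfSums_union [DecidableEq ι] {φ ψ : Dual k V} (hV : finrank k V = 2)
    (h : LinearIndependent k ![φ, ψ]) {c d : k} {m n : ℕ} {I J : Finset ι} (hIJ : Disjoint I J)
    (hI : FillsFiber a φ c m I) (hJ : FillsFiber a ψ d n J) :
    HasFullHalfSums a (I ∪ J) (m + n) := by
  refine ⟨I ∪ J, Subset.rfl, m + n, by push_cast; rfl,
    by rw [card_union_of_disjoint hIJ, hI.1, hJ.1, mul_add], fun v => ?_⟩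
  obtain ⟨u, hu⟩ := (bijective_prod_of_linearIndependent hV h).2 (m • c, ψ v - n • d)
  obtain ⟨hφu, hψu⟩ : φ u = m • c ∧ ψ u = ψ v - n • d := Prod.mk.inj hu
  obtain ⟨T, hTI, hTm, hTu⟩ := hI.2 u hφu
  obtain ⟨T', hTJ, hTn, hTv⟩ := hJ.2 (v - u) (by rw [map_sub, hψu, sub_sub_cancel])
  have hdisj : Disjoint T T' := hIJ.mono hTI hTJ
  exact ⟨T ∪ T', union_subset_union hTI hTJ, by rw [card_union_of_disjoint hdisj, hTm, hTn],
    by rw [sum_union hdisj, hTu, hTv, add_sub_cancel]⟩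

lemma FillsLines.hasFullHalfSums_of_linearIndependent [DecidableEq k] [DecidableEq V] {N M : ℝ}
    (hfill : FillsLines k a S N M) (hV : finrank k V = 2)
    (hmult : ∀ v, (#{i ∈ S | a i = v} : ℝ) ≤ N) {φ ψ : Dual k V}
    (h : LinearIndependent k ![φ, ψ]) {c d : k} (hc : 2 * N ≤ #{i ∈ S | φ (a i) = c})
    (hd : 2 * N ≤ #{i ∈ S | ψ (a i) = d}) : HasFullHalfSums a S (2 * M) := by
  classical
  set L := {i ∈ S | φ (a i) = c} with hL
  set L' := {i ∈ S | ψ (a i) = d} with hL'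
  have hinter : (#(L' ∩ L) : ℝ) ≤ N := by
    rw [hL', hL, inter_comm, ← filter_and]
    exact card_filter_and_le_of_linearIndependent hV h hmult c d
  have hsplit : (#(L' ∩ L) + #(L' \ L) : ℝ) = #L' := by
    exact_mod_cast card_inter_add_card_sdiff L' L
  have hLS : L ⊆ S := filter_subset _ _
  have hLS' : L' \ L ⊆ S := sdiff_subset.trans (filter_subset _ _)
  obtain ⟨I, hIL, m, hm, hI⟩ := hfill φ (h.ne_zero 0) c L hLS (fun i hi => (mem_filter.1 hi).2)
    (by linarith)
  obtain ⟨J, hJL, n, hn, hJ⟩ := hfill ψ (h.ne_zero 1) d (L' \ L) hLS'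
    (fun i hi => (mem_filter.1 (mem_sdiff.1 hi).1).2) (by linarith)
  exact (hI.hasFullHalfSums_union hV h (disjoint_sdiff.mono hIL hJL) hJ).mono
    (union_subset (hIL.trans hLS) (hJL.trans hLS')) (by linarith)

theorem exists_delta_fillsLines {η θ : ℝ} (hη : 0 < η) (hθ : 0 < θ) :
    ∃ δ : ℝ, 0 < δ ∧ ∀ (p : ℕ) [Fact p.Prime] (V : Type u) [AddCommGroup V] [Module (ZMod p) V]
      [DecidableEq V], finrank (ZMod p) V = 2 → ∀ (ι : Type v) (a : ι → V) (S : Finset ι),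
        (∀ v, (#{i ∈ S | a i = v} : ℝ) ≤ δ * p) → FillsLines (ZMod p) a S (η * p) (θ * p) := by
  obtain ⟨δ, hδ, hfull⟩ := exists_delta_hasFullHalfSums.{0, v} hη hθ one_pos le_rfl one_pos
  refine ⟨δ, hδ, fun p _ V _ _ _ hV ι a S hmult φ hφ c L hLS hL hcard => ?_⟩
  obtain ⟨ψ, hψ⟩ := exists_linearIndependent_dual hV hφ
  have hsparse : HyperplaneSparse p (fun i => ψ (a i)) L (δ * p) := fun χ hχ d => by
    have hone : χ 1 ≠ 0 := fun h => hχ (LinearMap.ext_ring h)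
    have hsub : {i ∈ L | χ (ψ (a i)) = d} ⊆ {i ∈ S | φ (a i) = c ∧ ψ (a i) = d / χ 1} := by
      intro i hi
      obtain ⟨hiL, rfl⟩ := mem_filter.1 hi
      refine mem_filter.2 ⟨hLS hiL, hL i hiL, ?_⟩
      rw [eq_div_iff hone, ← smul_eq_mul, ← map_smul, smul_eq_mul, mul_one]
    exact (Nat.cast_le.2 (card_le_card hsub)).trans
      (card_filter_and_le_of_linearIndependent hV hψ hmult c _)
  obtain ⟨I, hIL, m, hm, hcardI, hI⟩ := hfull p (ZMod p) (finrank_self _) expandsAlongBases_one ι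
    _ L hcard hsparse
  refine ⟨I, hIL, m, hm, hcardI, fun v hv => ?_⟩
  obtain ⟨T, hTI, hTm, hT⟩ := hI (ψ v)
  refine ⟨T, hTI, hTm, (bijective_prod_of_linearIndependent hV hψ).1 (Prod.ext ?_ ?_)⟩
  · change φ (∑ i ∈ T, a i) = φ v
    rw [map_sum, sum_congr rfl fun i hi => hL i (hIL (hTI hi)), sum_const, hTm, hv]
  · change ψ (∑ i ∈ T, a i) = ψ v
    rw [map_sum, hT]

end Lines

section Dichotomy

lemma card_large_fibers_mul_le {ι W : Type*} [DecidableEq W] (f : ι → W) (S : Finset ι) (K : ℝ) :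
    #{c ∈ S.image f | K ≤ #{i ∈ S | f i = c}} * K ≤ #S := by
  set C := {c ∈ S.image f | K ≤ #{i ∈ S | f i = c}}
  calc #C * K = #C • K := (nsmul_eq_mul _ _).symm
    _ ≤ ∑ c ∈ C, (#{i ∈ S | f i = c} : ℝ) :=
        card_nsmul_le_sum _ _ _ fun c hc => (mem_filter.1 hc).2
    _ ≤ ∑ c ∈ S.image f, (#{i ∈ S | f i = c} : ℝ) :=
        sum_le_sum_of_subset_of_nonneg (filter_subset _ _) fun _ _ _ => Nat.cast_nonneg _
    _ = #S := by exact_mod_cast (card_eq_sum_card_image f S).symm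

variable {ι k V : Type*} [Field k] [DecidableEq k] [AddCommGroup V] [Module k V] {a : ι → V}
  {S : Finset ι} {φ : Dual k V}

lemma liftsZeroSums_of_fillsFiber [DecidableEq ι] {C : Finset k} {I : k → Finset ι} {m : k → ℕ}
    {M X : ℝ} (hIS : ∀ c ∈ C, I c ⊆ S) (hm : ∀ c ∈ C, m c ≤ M)
    (hI : ∀ c ∈ C, FillsFiber a φ c (m c) (I c)) (hX : #C * M ≤ X) :
    LiftsZeroSums a φ ({i ∈ S | φ (a i) ∈ C} \ C.biUnion I) S X := by
  intro B hB hsum hBX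
  have hBS : B ⊆ S := hB.trans (sdiff_subset.trans (filter_subset _ _))
  have hmaps : ∀ i ∈ B, φ (a i) ∈ C := fun i hi => (mem_filter.1 (mem_sdiff.1 (hB hi)).1).2
  obtain rfl | hBne := B.eq_empty_or_nonempty
  · exact ⟨∅, empty_subset _, rfl, sum_empty⟩
  obtain ⟨c, hc, hMc⟩ := exists_le_card_fiber_of_nsmul_le_card_of_maps_to hmaps
    (hBne.elim fun i hi => ⟨_, hmaps i hi⟩) (b := M) (by rw [nsmul_eq_mul]; exact hX.trans hBX)
  have hdisj : Disjoint (I c) B := disjoint_of_subset_right hB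
    (disjoint_sdiff.mono_left (subset_biUnion_of_mem I hc))
  obtain ⟨B', hB', hcard, hzero⟩ := (hI c hc).exists_sum_eq_zero hdisj hsum
    (Nat.cast_le.1 ((hm c hc).trans hMc))
  exact ⟨B', hB'.trans (union_subset (hIS c hc) hBS), hcard, hzero⟩

lemma FillsLines.exists_liftsZeroSums {K M X : ℝ} (hfill : FillsLines k a S K M) (hφ : φ ≠ 0)
    (hK : 0 < K) (hM : 0 ≤ M) (hX : #S * M ≤ X * K) :
    ∃ R ⊆ S, (#{i ∈ S | K ≤ #{j ∈ S | φ (a j) = φ (a i)}} : ℝ) ≤ #R + 2 * X ∧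
      LiftsZeroSums a φ R S X := by
  classical
  set C := {c ∈ S.image fun i => φ (a i) | K ≤ #{i ∈ S | φ (a i) = c}}
  have hCX : #C * M ≤ X := by
    have hCK : #C * K ≤ #S := card_large_fibers_mul_le _ S K
    refine le_of_mul_le_mul_right ?_ hK
    calc #C * M * K = #C * K * M := by ring
      _ ≤ #S * M := by gcongr
      _ ≤ X * K := hX
  have hfill' : ∀ c ∈ C, ∃ I ⊆ S, ∃ m : ℕ, m ≤ M ∧ FillsFiber a φ c m I := fun c hc => by
    obtain ⟨I, hI, hm⟩ := hfill φ hφ c _ (filter_subset _ S) (fun i hi => (mem_filter.1 hi).2)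
      (mem_filter.1 hc).2
    exact ⟨I, hI.trans (filter_subset _ _), hm⟩
  choose! I hIS m hm hI using hfill'
  have hR : {i ∈ S | K ≤ #{j ∈ S | φ (a j) = φ (a i)}} = {i ∈ S | φ (a i) ∈ C} :=
    filter_congr fun i hi => by simp [C, mem_filter, mem_image_of_mem (fun i => φ (a i)) hi]
  have hunion : (#(C.biUnion I) : ℝ) ≤ 2 * X :=
    calc (#(C.biUnion I) : ℝ) ≤ ∑ c ∈ C, (#(I c) : ℝ) := by exact_mod_cast card_biUnion_le
      _ ≤ #C • (2 * M) := sum_le_card_nsmul _ _ _ fun c hc => by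
          rw [(hI c hc).1, Nat.cast_mul, Nat.cast_two]
          linarith [hm c hc]
      _ ≤ 2 * X := by rw [nsmul_eq_mul]; linarith
  refine ⟨_, sdiff_subset.trans (filter_subset _ _), ?_,
    liftsZeroSums_of_fillsFiber hIS hm hI hCX⟩
  have hsplit : (#{i ∈ S | φ (a i) ∈ C} : ℝ) ≤
      #({i ∈ S | φ (a i) ∈ C} \ C.biUnion I) + #(C.biUnion I) := by
    exact_mod_cast card_le_card_sdiff_add_card
  rw [hR]
  linarith

end Dichotomy

section Plane

variable {ι : Type*} {p : ℕ} [Fact p.Prime] {V : Type*} [AddCommGroup V] [Module (ZMod p) V]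
  {a : ι → V} {S : Finset ι} {K : ℝ}

lemma exists_hyperplaneSparse_of_dependent [Nontrivial V] (hK : 0 ≤ K)
    (hdep : ∀ φ ψ : Dual (ZMod p) V, LinearIndependent (ZMod p) ![φ, ψ] → ∀ c d,
      K ≤ #{i ∈ S | φ (a i) = c} → (#{i ∈ S | ψ (a i) = d} : ℝ) < K) :
    ∃ φ : Dual (ZMod p) V, φ ≠ 0 ∧
      HyperplaneSparse p a {i ∈ S | ¬ K ≤ #{j ∈ S | φ (a j) = φ (a i)}} K := by
  by_cases hrich : ∃ φ : Dual (ZMod p) V, φ ≠ 0 ∧ ∃ c, K ≤ #{i ∈ S | φ (a i) = c}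
  · obtain ⟨φ, hφ, c, hc⟩ := hrich
    refine ⟨φ, hφ, fun ψ hψ d => ?_⟩
    set Q := {i ∈ S | ¬ K ≤ #{j ∈ S | φ (a j) = φ (a i)}}
    by_contra! hlarge
    have hψrich : K ≤ #{i ∈ S | ψ (a i) = d} := hlarge.le.trans
      (Nat.cast_le.2 (card_le_card (filter_subset_filter _ (filter_subset _ _))))
    have hpar : ¬LinearIndependent (ZMod p) ![φ, ψ] := fun h => (hdep φ ψ h c d hc).not_ge hψrich
    obtain ⟨i, hi⟩ := card_pos.1 (Nat.cast_pos.1 (hK.trans_lt hlarge))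
    obtain ⟨hiQ, rfl⟩ := mem_filter.1 hi
    refine (mem_filter.1 hiQ).2 (hψrich.trans (Nat.cast_le.2 (card_le_card ?_)))
    exact monotone_filter_right S fun j _ hj => apply_eq_of_not_linearIndependent hψ hpar hj
  · push Not at hrich
    obtain ⟨φ, hφ⟩ := exists_ne (0 : Dual (ZMod p) V)
    exact ⟨φ, hφ, fun ψ hψ d => ((Nat.cast_le.2 (card_le_card
      (filter_subset_filter _ (filter_subset _ _)))).trans_lt (hrich ψ hψ d)).le⟩

theorem exists_delta_hasFullHalfSums_or_liftsZeroSums {ε : ℝ} (hε : 0 < ε) :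
    ∃ δ : ℝ, 0 < δ ∧ ∀ (p : ℕ) [Fact p.Prime] (V : Type u) [AddCommGroup V] [Module (ZMod p) V]
      [DecidableEq V], finrank (ZMod p) V = 2 → ∀ (ι : Type v) (a : ι → V) (S : Finset ι),
        #S ≤ 4 * (p : ℝ) → (∀ v, (#{i ∈ S | a i = v} : ℝ) ≤ δ * p) →
          HasFullHalfSums a S (ε / 2 * p) ∨ ∃ R ⊆ S, #S ≤ #R + ε / 2 * p ∧
            ∃ φ : Dual (ZMod p) V, LiftsZeroSums a φ R S (ε / 8 * p) := by
  obtain ⟨δ₁, hδ₁, hplane⟩ := exists_delta_hasFullHalfSums.{u, v} (η := ε / 4) (θ := ε / 2)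
    (c := 1 / 12) (by positivity) (by positivity) (by norm_num) (by norm_num) two_pos
  set θ := min (ε * δ₁ / 32) (ε / 4)
  have hθ : 0 < θ := lt_min (by positivity) (by positivity)
  obtain ⟨δ₂, hδ₂, hlines⟩ := exists_delta_fillsLines.{u, v} (η := δ₁ / 2) (half_pos hδ₁) hθ
  refine ⟨min δ₂ (δ₁ / 2), lt_min hδ₂ (half_pos hδ₁), fun p _ V _ _ _ hV ι a S hS hmult => ?_⟩
  have hp : (0 : ℝ) < p := by exact_mod_cast (Fact.out : p.Prime).pos
  have hθ₁ : θ ≤ ε * δ₁ / 32 := min_le_left _ _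
  have hθ₂ : θ ≤ ε / 4 := min_le_right _ _
  have hfill : FillsLines (ZMod p) a S (δ₁ / 2 * p) (θ * p) :=
    hlines p V hV ι a S fun v => (hmult v).trans (by gcongr; exact min_le_left _ _)
  by_cases hcross : ∃ φ ψ : Dual (ZMod p) V, LinearIndependent (ZMod p) ![φ, ψ] ∧ ∃ c d,
      δ₁ * p ≤ #{i ∈ S | φ (a i) = c} ∧ δ₁ * p ≤ #{i ∈ S | ψ (a i) = d}
  · obtain ⟨φ, ψ, h, c, d, hc, hd⟩ := hcross
    refine .inl ((hfill.hasFullHalfSums_of_linearIndependent hV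
      (fun v => (hmult v).trans (by gcongr; exact min_le_right _ _)) h
      (c := c) (d := d) (by linarith) (by linarith)).mono Subset.rfl ?_)
    nlinarith
  push Not at hcross
  have := nontrivial_of_finrank_pos (R := ZMod p) (M := V) (by omega)
  have := finite_of_finrank_eq_succ hV
  have : Finite V := finite_of_finite (ZMod p)
  have := Fintype.ofFinite V
  obtain ⟨φ, hφ, hsparse⟩ := exists_hyperplaneSparse_of_dependent (by positivity) hcross
  set Q := {i ∈ S | ¬δ₁ * p ≤ #{j ∈ S | φ (a j) = φ (a i)}}
  obtain hQ | hQ := le_or_gt (ε / 4 * p) #Q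
  · exact .inl ((hplane p V hV expandsAlongBases_two ι a Q hQ hsparse).mono (filter_subset _ _)
      le_rfl)
  obtain ⟨R, hRS, hR, hlift⟩ := (hfill.mono (N' := δ₁ * p) (by nlinarith)).exists_liftsZeroSums hφ
    (X := ε / 8 * p) (by positivity) (by positivity) (by
      calc (#S : ℝ) * (θ * p) ≤ 4 * p * (ε * δ₁ / 32 * p) := by gcongr
        _ = ε / 8 * p * (δ₁ * p) := by ring)
  refine .inr ⟨R, hRS, ?_, φ, hlift⟩
  have hsplit : (#{i ∈ S | δ₁ * p ≤ #{j ∈ S | φ (a j) = φ (a i)}} + #Q : ℝ) = #S := by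
    exact_mod_cast card_filter_add_card_filter_not _
  linarith

end Plane

section ZeroSums

variable {ι : Type*} {S : Finset ι}

lemma exists_zero_sum_card_le {n : ℕ} (hn : 0 < n) (b : ι → ZMod n) (hS : n ≤ #S) :
    ∃ T ⊆ S, T.Nonempty ∧ #T ≤ n ∧ ∑ i ∈ T, b i = 0 := by
  -- Apply Erdős–Ginzburg–Ziv after padding `b` with `n - 1` zeros, too few to fill a zero-sum.
  obtain ⟨T, hT, hTn, hsum⟩ := ZMod.erdos_ginzburg_ziv (n := n)
    (s := S.disjSum (univ : Finset (Fin (n - 1)))) (Sum.elim b 0) (by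
      rw [card_disjSum, card_univ, Fintype.card_fin]
      omega)
  have hcard := card_toLeft_add_card_toRight (u := T)
  have hzeros : #T.toRight ≤ n - 1 := by simpa using card_le_univ T.toRight
  refine ⟨T.toLeft, fun i hi => by simpa using hT (mem_toLeft.1 hi), card_pos.1 (by omega),
    by omega, ?_⟩
  rw [← toLeft_disjSum_toRight (u := T), sum_disjSum] at hsum
  simpa using hsum

lemma exists_zero_sum_card_mem_Icc {n N : ℕ} (hn : 0 < n) (hN : 2 * N ≤ n) (b : ι → ZMod n)
    (hS : n + N ≤ #S) : ∃ T ⊆ S, N ≤ #T ∧ #T ≤ n ∧ ∑ i ∈ T, b i = 0 := by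
  classical
  obtain ⟨T, hT, hmax⟩ := exists_max_image {T ∈ S.powerset | #T ≤ n ∧ ∑ i ∈ T, b i = 0} card
    ⟨∅, by simp⟩
  obtain ⟨hTS, hTn, hTsum⟩ : T ⊆ S ∧ #T ≤ n ∧ ∑ i ∈ T, b i = 0 := by simpa using hT
  refine ⟨T, hTS, ?_, hTn, hTsum⟩
  by_contra! hlt
  have hsplit := card_sdiff_add_card_eq_card hTS
  obtain ⟨T', hT', hne, hTn', hTsum'⟩ := exists_zero_sum_card_le hn b (S := S \ T) (by omega)
  have hTS' : T' ⊆ S := hT'.trans sdiff_subset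
  have hdisj : Disjoint T T' := disjoint_of_subset_right hT' disjoint_sdiff
  have hcard := card_union_of_disjoint hdisj
  have hpos := hne.card_pos
  have hle : #T' ≤ #T := hmax T' (by simp [hTS', hTn', hTsum'])
  have hle_union : #(T ∪ T') ≤ #T := hmax (T ∪ T') (mem_filter.2
    ⟨mem_powerset.2 (union_subset hTS hTS'), by omega, by
      rw [sum_union hdisj, hTsum, hTsum', add_zero]⟩)
  omega

variable {G : Type*} [AddCommGroup G] {a : ι → G} {M : ℝ} {n : ℕ}

lemma HasFullHalfSums.exists_zero_sum_card_le [Nontrivial G] (h : HasFullHalfSums a S M)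
    (hM : M ≤ n) : ∃ T ⊆ S, T.Nonempty ∧ #T ≤ n ∧ ∑ i ∈ T, a i = 0 := by
  obtain ⟨I, hIS, m, hm, -, hfull⟩ := h
  obtain ⟨v, hv⟩ := exists_ne (0 : G)
  obtain ⟨T', -, hTm', rfl⟩ := hfull v
  obtain ⟨i, hi, -⟩ := exists_ne_zero_of_sum_ne_zero hv
  obtain ⟨T, hTI, hTm, hsum⟩ := hfull 0
  refine ⟨T, hTI.trans hIS, ?_, Nat.cast_le.1 ((hTm ▸ hm).trans hM), hsum⟩
  exact card_pos.1 (hTm.trans hTm'.symm ▸ card_pos.2 ⟨i, hi⟩)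

lemma HasFullHalfSums.exists_zero_sum_card_eq (h : HasFullHalfSums a S M) (hM : M ≤ n)
    (hS : n + M ≤ #S) : ∃ T ⊆ S, #T = n ∧ ∑ i ∈ T, a i = 0 := by
  classical
  obtain ⟨I, hIS, m, hm, hcardI, hfull⟩ := h
  have hmn : m ≤ n := Nat.cast_le.1 (hm.trans hM)
  have hmS : n + m ≤ #S := by
    have : (n + m : ℝ) ≤ #S := by linarith
    exact_mod_cast this
  have hsplit := card_sdiff_add_card_eq_card hIS
  obtain ⟨F, hF, hFcard⟩ := exists_subset_card_eq (s := S \ I) (n := n - m) (by omega)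
  obtain ⟨T, hTI, hTm, hsum⟩ := hfull (-∑ i ∈ F, a i)
  have hdisj : Disjoint T F := disjoint_sdiff.mono hTI hF
  refine ⟨T ∪ F, union_subset (hTI.trans hIS) (hF.trans sdiff_subset), ?_, ?_⟩
  · rw [card_union_of_disjoint hdisj]
    omega
  · rw [sum_union hdisj, hsum, neg_add_cancel]

variable {V : Type*} [AddCommGroup V] [Module (ZMod n) V] {w : ι → V} {φ : Dual (ZMod n) V}
  {R : Finset ι} {N : ℝ}

lemma LiftsZeroSums.exists_zero_sum_card_le (h : LiftsZeroSums w φ R S N) (hN : 0 < N)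
    (hNn : 2 * (N + 1) ≤ n) (hR : n + (N + 1) ≤ #R) :
    ∃ T ⊆ S, T.Nonempty ∧ #T ≤ n ∧ ∑ i ∈ T, w i = 0 := by
  have hceil := Nat.ceil_lt_add_one hN.le
  have hn₀ : 0 < n := by
    have : (0 : ℝ) < n := by linarith
    exact_mod_cast this
  have hNn' : 2 * ⌈N⌉₊ ≤ n := by
    have : (2 * ⌈N⌉₊ : ℝ) ≤ n := by linarith
    exact_mod_cast this
  have hR' : n + ⌈N⌉₊ ≤ #R := by
    have : (n + ⌈N⌉₊ : ℝ) ≤ #R := by linarith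
    exact_mod_cast this
  obtain ⟨B, hBR, hNB, hBn, hsum⟩ := exists_zero_sum_card_mem_Icc hn₀ hNn' (fun i => φ (w i)) hR'
  obtain ⟨T, hTS, hTB, hT⟩ := h B hBR hsum (Nat.ceil_le.1 hNB)
  refine ⟨T, hTS, card_pos.1 ?_, hTB.trans_le hBn, hT⟩
  exact hTB ▸ (Nat.ceil_pos.2 hN).trans_le hNB

lemma LiftsZeroSums.exists_zero_sum_card_eq (h : LiftsZeroSums w φ R S N) (hN : N ≤ n)
    (hR : 2 * n ≤ #R) : ∃ T ⊆ S, #T = n ∧ ∑ i ∈ T, w i = 0 := by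
  obtain ⟨B, hBR, hBn, hsum⟩ := ZMod.erdos_ginzburg_ziv (s := R) (fun i => φ (w i))
    (tsub_le_self.trans hR)
  obtain ⟨T, hTS, hTB, hT⟩ := h B hBR hsum (by rwa [hBn])
  exact ⟨T, hTS, hTB.trans hBn, hT⟩

lemma exists_subset_lt_card_le {x : ℝ} (hx : 0 ≤ x) (hS : x < #S) :
    ∃ T ⊆ S, x < #T ∧ #T ≤ x + 1 := by
  obtain ⟨T, hTS, hT⟩ := exists_subset_card_eq ((Nat.floor_lt hx).2 hS)
  refine ⟨T, hTS, ?_, ?_⟩ <;> rw [hT, Nat.cast_succ]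
  · exact Nat.lt_floor_add_one x
  · gcongr
    exact Nat.floor_le hx

end ZeroSums

theorem exists_delta_subset_hasFullHalfSums_or_liftsZeroSums {ε : ℝ} (hε : 0 < ε) :
    ∃ δ : ℝ, 0 < δ ∧ ∀ (p : ℕ) [Fact p.Prime] (V : Type u) [AddCommGroup V] [Module (ZMod p) V]
      [DecidableEq V], finrank (ZMod p) V = 2 → ∀ (ι : Type v) (a : ι → V) (S : Finset ι),
        (∀ v, (#{i ∈ S | a i = v} : ℝ) ≤ δ * p) → ∀ b : ℝ, 0 ≤ b → b ≤ 3 → b * p < #S →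
          4 ≤ ε * p ∧ ∃ S' ⊆ S, b * p < #S' ∧
            (HasFullHalfSums a S' (ε / 2 * p) ∨ ∃ R ⊆ S', #S' ≤ #R + ε / 2 * p ∧
              ∃ φ : Dual (ZMod p) V, LiftsZeroSums a φ R S' (ε / 8 * p)) := by
  obtain ⟨δ, hδ, hdich⟩ := exists_delta_hasFullHalfSums_or_liftsZeroSums.{u, v} hε
  refine ⟨min δ (ε / 4), lt_min hδ (by positivity),
    fun p _ V _ _ _ hV ι a S hmult b hb₀ hb₃ hbS => ?_⟩
  have hp : (1 : ℝ) ≤ p := by exact_mod_cast (Fact.out : p.Prime).one_le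
  have hbp : 0 ≤ b * p := by positivity
  obtain ⟨i, hi⟩ := card_pos.1 (Nat.cast_pos.1 (hbp.trans_lt hbS))
  have hmult_one : (1 : ℝ) ≤ #{j ∈ S | a j = a i} :=
    Nat.one_le_cast.2 (card_pos.2 ⟨i, mem_filter.2 ⟨hi, rfl⟩⟩)
  obtain ⟨S', hS', hlt, hle⟩ := exists_subset_lt_card_le hbp hbS
  refine ⟨?_, S', hS', hlt, hdich p V hV ι a S' (by nlinarith) fun v => ?_⟩
  · nlinarith [hmult_one.trans (hmult (a i)), min_le_right δ (ε / 4)]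
  · calc (#{i ∈ S' | a i = v} : ℝ) ≤ #{i ∈ S | a i = v} :=
          Nat.cast_le.2 (card_le_card (filter_subset_filter _ hS'))
      _ ≤ min δ (ε / 4) * p := hmult v
      _ ≤ δ * p := by gcongr; exact min_le_left _ _

theorem exists_delta_zero_sums {ε : ℝ} (hε : 0 < ε) (hε₁ : ε ≤ 1) :
    ∃ δ : ℝ, 0 < δ ∧ ∀ (p : ℕ) [Fact p.Prime] (V : Type u) [AddCommGroup V] [Module (ZMod p) V]
      [DecidableEq V], finrank (ZMod p) V = 2 → ∀ (ι : Type v) (a : ι → V) (S : Finset ι),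
        (∀ v, (#{i ∈ S | a i = v} : ℝ) ≤ δ * p) →
          ((1 + ε) * p < #S → ∃ T ⊆ S, T.Nonempty ∧ #T ≤ p ∧ ∑ i ∈ T, a i = 0) ∧
          ((2 + ε) * p < #S → ∃ T ⊆ S, #T = p ∧ ∑ i ∈ T, a i = 0) := by
  obtain ⟨δ, hδ, hdich⟩ := exists_delta_subset_hasFullHalfSums_or_liftsZeroSums.{u, v} hε
  refine ⟨δ, hδ, fun p _ V _ _ _ hV ι a S hmult => ?_⟩
  have := nontrivial_of_finrank_pos (R := ZMod p) (M := V) (by omega)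
  have hεp : ε * p ≤ p := mul_le_of_le_one_left p.cast_nonneg hε₁
  constructor <;> intro hS
  · obtain ⟨hεp₄, S', hS', hlt, hfull | ⟨R, -, hR, φ, hlift⟩⟩ :=
      hdich p V hV ι a S hmult _ (by linarith) (by linarith) hS
    · exact (hfull.exists_zero_sum_card_le (by linarith)).imp fun T hT => ⟨hT.1.trans hS', hT.2⟩
    · exact (hlift.exists_zero_sum_card_le (by linarith) (by linarith) (by linarith)).imp
        fun T hT => ⟨hT.1.trans hS', hT.2⟩
  · obtain ⟨hεp₄, S', hS', hlt, hfull | ⟨R, -, hR, φ, hlift⟩⟩ :=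
      hdich p V hV ι a S hmult _ (by linarith) (by linarith) hS
    · exact (hfull.exists_zero_sum_card_eq (by linarith) (by linarith)).imp
        fun T hT => ⟨hT.1.trans hS', hT.2⟩
    · have hR₂ : (2 * p : ℝ) ≤ #R := by linarith
      exact (hlift.exists_zero_sum_card_eq (by linarith) (by exact_mod_cast hR₂)).imp
        fun T hT => ⟨hT.1.trans hS', hT.2⟩

theorem theorem4_general {ε : ℝ} (hε : 0 < ε) :
    ∃ δ : ℝ, 0 < δ ∧ ∀ (p : ℕ) [Fact p.Prime] (V : Type u) [AddCommGroup V] [Module (ZMod p) V]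
      [DecidableEq V], finrank (ZMod p) V = 2 → ∀ A : Multiset V,
        (∀ v ∈ A, A.count v ≤ δ * p) →
          ((1 + ε) * p < A.card → ∃ B ≤ A, B ≠ 0 ∧ B.card ≤ p ∧ B.sum = 0) ∧
          ((2 + ε) * p < A.card → ∃ B ≤ A, B.card = p ∧ B.sum = 0) := by
  obtain ⟨δ, hδ, hzero⟩ :=
    exists_delta_zero_sums.{u, u} (lt_min hε one_pos) (min_le_right ε 1)
  refine ⟨δ, hδ, fun p _ V _ _ _ hV A hA => ?_⟩
  have hmult : ∀ v, (#{i ∈ A.toEnumFinset | i.1 = v} : ℝ) ≤ δ * p := fun v => by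
    rw [Multiset.toEnumFinset_filter_eq, card_product, card_singleton, one_mul, card_range]
    by_cases hv : v ∈ A
    · exact hA v hv
    · rw [Multiset.count_eq_zero_of_notMem hv, Nat.cast_zero]
      positivity
  obtain ⟨hshort, hexact⟩ := hzero p V hV _ Prod.fst A.toEnumFinset hmult
  rw [Multiset.card_toEnumFinset] at hshort hexact
  have hmin : min ε 1 * p ≤ ε * p := by gcongr; exact min_le_left _ _
  constructor <;> intro hcard
  · obtain ⟨T, hTA, hne, hTp, hsum⟩ := hshort (by linarith)
    exact ⟨T.1.map Prod.fst, Multiset.map_fst_le_of_subset_toEnumFinset hTA,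
      by simpa using hne.ne_empty, by rwa [Multiset.card_map], hsum⟩
  · obtain ⟨T, hTA, hTp, hsum⟩ := hexact (by linarith)
    exact ⟨T.1.map Prod.fst, Multiset.map_fst_le_of_subset_toEnumFinset hTA,
      by rwa [Multiset.card_map], hsum⟩

theorem theorem4 :
    ∀ ε : ℝ, 0 < ε → ∃ δ : ℝ, 0 < δ ∧ ∃ P : ℕ, ∀ p : ℕ, p.Prime → P ≤ p →
      ∀ A : Multiset (ZMod p × ZMod p),
        (∀ a ∈ A, (A.count a : ℝ) < δ * (p : ℝ)) →
          ((1 + ε) * (p : ℝ) < (Multiset.card A : ℝ) →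
            ∃ B : Multiset (ZMod p × ZMod p),
              B ≤ A ∧ B ≠ 0 ∧ Multiset.card B ≤ p ∧ B.sum = 0) ∧
          ((2 + ε) * (p : ℝ) < (Multiset.card A : ℝ) →
            ∃ B : Multiset (ZMod p × ZMod p),
              B ≤ A ∧ Multiset.card B = p ∧ B.sum = 0) := by
  intro ε hε
  obtain ⟨δ, hδ, hzero⟩ := theorem4_general hε
  refine ⟨δ, hδ, 0, fun p hp _ A hA => ?_⟩
  have := Fact.mk hp
  exact hzero p _ (by rw [finrank_prod, finrank_self]) A fun a ha => (hA a ha).le
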